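/- A $(K,L,M,N)$ multiaccess coded caching problem with private demands ($1\le L\le K$, $N\ge 1$) has a server with $N$ independent files $W_1,\dots,W_N$ of $B$ i.i.d. uniform bits each, $K$ cache-nodes $C_1,\dots,C_K$ and $K$ users $U_1,\dots,U_K$; user $U_k$ has access to the $L$ cache-nodes $C_k,C_{k+1},\dots,C_{k+L-1}$ (indices modulo $K$). The server generates finite-valued random variables $V_1,\dots,V_K$, jointly distributed and independent of the files; cache-node $C_k$ stores $Z_{C_k}=\phi_k(W_1,\dots,W_N,V_k)$, of at most $MB$ bits, and $Z_{U_k}$ denotes the collection of the contents of the $L$ cache-nodes accessed by $U_k$. For the demand vector $\mathbf d=(d_1,\dots,d_K)\in[N]^K$, which is independent of the files and of $V_1,\dots,V_K$, the server broadcasts a message $X=\psi(\mathbf d,W_1,\dots,W_N,V_1,\dots,V_K)$ of a fixed number of bits. It is required that, for every distribution of $\mathbf d$ and every $k\in[K]$, $$H(W_{d_k}\mid X,d_k,Z_{U_k})=0,\qquad I(\mathbf d_{-k};X,Z_{U_k}\mid d_k)=0,$$ where $\mathbf d_{-k}$ consists of the demands of all users except $U_k$. A pair $(M,R)$ is achievable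 if for every $\varepsilon>0$ and all sufficiently large $B$ there is such a scheme with caches of at most $MB$ bits and a message of at most $(R+\varepsilon)B$ bits. Theorem 2. Let $1\le L\le K$ and $N\ge1$. Every point of the lower convex envelope (the lower boundary of the convex hull) of the following set of memory-load points is achievable: the point $\left(\frac NL,0\right)$ and, if $L<\frac K2+1$, also the points $$(M,R)=\left(\frac{(N-2L)t}{K}+2,\ \frac{K-tL}{t+1}\right),\qquad t\in\{1,2,\dots,\lfloor K/L\rfloor\}.$$ -/

import Mathlib

/-! ### Shannon information measures of finite-valued random variables

A finite probability space is a finite type `Ω` with a mass function `p : Ω → ℝ`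
(a point of `stdSimplex ℝ Ω`); a random variable is a function on `Ω`. -/

namespace FiniteInfo

variable {Ω α β γ : Type} [Fintype Ω] [Fintype α] [Fintype β] [Fintype γ]

open Classical in
/-- The probability of the event `X = a`. -/
noncomputable def prob {Ω α : Type} [Fintype Ω] (p : Ω → ℝ) (X : Ω → α) (a : α) : ℝ :=
  ∑ ω with X ω = a, p ω

/-- The conditional entropy `H(X | Y) = - ∑ P(x,y) log₂ P(x|y)`, in bits. Terms with
`P(x,y) = 0` contribute `0`. -/
noncomputable def condEntropy (p : Ω → ℝ) (X : Ω → α) (Y : Ω → β) : ℝ :=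
  -∑ x, ∑ y, prob p (fun ω => (X ω, Y ω)) (x, y) *
    Real.logb 2 (prob p (fun ω => (X ω, Y ω)) (x, y) / prob p Y y)

/-- The conditional mutual information
`I(X ; Y | Z) = ∑ P(x,y,z) log₂ (P(x,y,z) P(z) / (P(x,z) P(y,z)))`, in bits. Terms with
`P(x,y,z) = 0` contribute `0`. -/
noncomputable def condMutualInfo (p : Ω → ℝ) (X : Ω → α) (Y : Ω → β) (Z : Ω → γ) : ℝ :=
  ∑ x, ∑ y, ∑ z, prob p (fun ω => (X ω, Y ω, Z ω)) (x, y, z) *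
    Real.logb 2 (prob p (fun ω => (X ω, Y ω, Z ω)) (x, y, z) * prob p Z z /
      (prob p (fun ω => (X ω, Z ω)) (x, z) * prob p (fun ω => (Y ω, Z ω)) (y, z)))

end FiniteInfo

/-! ### Multiaccess coded caching with private demands -/

namespace MultiaccessCaching

/-- Strings of `b` bits. -/
abbrev Bits (b : ℕ) : Type := Fin b → ZMod 2

/-- Libraries of `N` files of `B` bits each. -/
abbrev Library (N B : ℕ) : Type := Fin N → Bits B

/-- Demand vectors: user `k` demands the file with index `d k`. -/
abbrev Demands (K N : ℕ) : Type := Fin K → Fin N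

/-- The `i`-th cache-node that user `k` is connected to: user `k` has access to the cache-nodes
`k, k + 1, …, k + L - 1`, taken modulo `K` (users and cache-nodes are numbered from `0`). -/
def node {K L : ℕ} (k : Fin K) (i : Fin L) : Fin K :=
  ⟨(k.val + i.val) % K, Nat.mod_lt _ k.pos⟩

/-- The placement and delivery maps of a caching scheme with `K` cache-nodes and `K` users, `N`
files of `B` bits, caches of `m` bits and broadcast messages of `l` bits. The server's random
variables `V 0, …, V (K - 1)` have finite ranges and a joint law `law`; they need not be
independent of one another. -/
structure Scheme (K N B m l : ℕ) where
  /-- The range of the random variable of cache-node `k`. -/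
  V : Fin K → Type
  /-- The ranges are finite. -/
  fintypeV : ∀ k, Fintype (V k)
  /-- The joint probability mass function of the random variables. -/
  law : (∀ k, V k) → ℝ
  /-- It is a probability mass function. -/
  law_mem : law ∈ stdSimplex ℝ (∀ k, V k)
  /-- The placement function of cache-node `k`, which does not know the demands. -/
  cache : ∀ k, Library N B → V k → Bits m
  /-- The delivery function, which gives the broadcast message. -/
  send : Demands K N → Library N B → (∀ k, V k) → Bits l

attribute [instance] Scheme.fintypeV

namespace Scheme

variable {K N B m l : ℕ} (s : Scheme K N B m l)

/-- Outcomes: the library, the server's random variables and the demand vector. -/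
abbrev Outcome : Type := Library N B × (∀ k, s.V k) × Demands K N

/-- The joint mass function of library, randomness and demands when the demand vector has mass
function `D`: the three are independent, and the `N * B` bits of the library are i.i.d. uniform. -/
noncomputable def joint (D : Demands K N → ℝ) : s.Outcome → ℝ :=
  fun ω => (Fintype.card (Library N B) : ℝ)⁻¹ * s.law ω.2.1 * D ω.2.2

/-- The file demanded by user `k`. -/
def wanted (k : Fin K) (ω : s.Outcome) : Bits B := ω.1 (ω.2.2 k)

/-- The demand of user `k`. -/
def demand (k : Fin K) (ω : s.Outcome) : Fin N := ω.2.2 k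

/-- The demands of all users except user `k`. -/
def otherDemands (k : Fin K) (ω : s.Outcome) : {j : Fin K // j ≠ k} → Fin N :=
  fun j => ω.2.2 j

/-- The broadcast message. -/
def message (ω : s.Outcome) : Bits l := s.send ω.2.2 ω.1 ω.2.1

/-- The contents that user `k` retrieves from its `L` cache-nodes. -/
def retrieved (L : ℕ) (k : Fin K) (ω : s.Outcome) : Fin L → Bits m :=
  fun i => s.cache (node k i) ω.1 (ω.2.1 (node k i))

/-- Every user can decode its demanded file, `H(W_{d_k} | X, d_k, Z_{U_k}) = 0`, whatever the
distribution of the demands. -/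
def Decodable (L : ℕ) : Prop :=
  ∀ D ∈ stdSimplex ℝ (Demands K N), ∀ k : Fin K,
    FiniteInfo.condEntropy (s.joint D) (s.wanted k)
      (fun ω => (s.message ω, s.demand k ω, s.retrieved L k ω)) = 0

/-- No user learns anything about the demands of the others,
`I(d_{-k} ; X, Z_{U_k} | d_k) = 0`, whatever the distribution of the demands. -/
def Private (L : ℕ) : Prop :=
  ∀ D ∈ stdSimplex ℝ (Demands K N), ∀ k : Fin K,
    FiniteInfo.condMutualInfo (s.joint D) (s.otherDemands k)
      (fun ω => (s.message ω, s.retrieved L k ω)) (s.demand k) = 0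

end Scheme

/-- The memory-load pair `(M, R)` is achievable for the multiaccess coded caching problem with
private demands: for every `ε > 0` and all large enough file sizes `B` there is a private scheme
with caches of at most `M * B` bits and broadcast messages of at most `(R + ε) * B` bits. -/
def Achievable (K L N : ℕ) (M R : ℝ) : Prop :=
  ∀ ε : ℝ, 0 < ε → ∃ B₀ : ℕ, ∀ B : ℕ, B₀ ≤ B → ∃ m l : ℕ,
    (m : ℝ) ≤ M * B ∧ (l : ℝ) ≤ (R + ε) * B ∧
      ∃ s : Scheme K N B m l, s.Decodable L ∧ s.Private L

/-- The lower convex envelope of a set of points in the plane: the lower boundary of the convex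
hull. -/
def lowerConvexEnvelope (P : Set (ℝ × ℝ)) : Set (ℝ × ℝ) :=
  {q | IsGLB {r : ℝ | (q.1, r) ∈ convexHull ℝ P} q.2}

end MultiaccessCaching

/-! Decodability and privacy follow from two combinatorial conditions (`PrivateScheme`): what a user
observes determines its file, and two demand vectors that agree at user `k` are related by a
bijection of the uniform randomness under which the observations of `k` do not change. Such schemes
can be run side by side on pieces of the files, so the nonnegative pairs they achieve form a convex
set and only the corner points remain.

The point `(N / L, 0)` comes from Reed-Solomon coding across the cache-nodes. For the others,
`expandedArray` turns the Maddah-Ali-Niesen placement into a multiaccess one. Privacy is added by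
`keyScheme`: user `k` is served the combination of files with public coefficients, a uniform vector
`p k` plus the unit vector of its demand, and removes the `p k` part with a key. The key is split
into two additive shares, held by the first and last cache-nodes of `k`. If `2 * L < K + 2`, no
other user reaches both (`eq_of_node_eq`), so the keys of the others reveal nothing. -/

/-! ### Criteria for vanishing conditional entropy and mutual information. -/

namespace FiniteInfo

variable {Ω α β γ : Type} [Fintype Ω] [Fintype α] [Fintype β] [Fintype γ]

open Classical in
theorem prob_eq_sum_mul {Ω α : Type} [Fintype Ω] (p : Ω → ℝ) (X : Ω → α) (a : α) :
    prob p X a = ∑ ω, p ω * (if X ω = a then 1 else 0) := by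
  simp [prob, Finset.sum_filter]

theorem sum_prob_prodMk {Ω α β : Type} [Fintype Ω] [Fintype α] (p : Ω → ℝ) (X : Ω → α)
    (Y : Ω → β) (y : β) :
    ∑ x, prob p (fun ω => (X ω, Y ω)) (x, y) = prob p Y y := by
  classical
  simp only [prob_eq_sum_mul, Prod.mk.injEq]
  rw [Finset.sum_comm]
  refine Finset.sum_congr rfl fun ω _ => ?_
  rw [← Finset.mul_sum]
  congr 1
  simp [ite_and]

/-- A random variable that is almost surely a function of another one has no conditional entropy
given it. -/
theorem condEntropy_eq_zero (p : Ω → ℝ) (X : Ω → α) (Y : Ω → β)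
    (h : ∀ ω ω', p ω ≠ 0 → p ω' ≠ 0 → Y ω = Y ω' → X ω = X ω') : condEntropy p X Y = 0 := by
  classical
  rw [condEntropy, neg_eq_zero]
  refine Finset.sum_eq_zero fun x _ => Finset.sum_eq_zero fun y _ => ?_
  by_cases hxy : ∃ ω, p ω ≠ 0 ∧ X ω = x ∧ Y ω = y
  · obtain ⟨ω, hω, hx, hy⟩ := hxy
    have hprob : prob p (fun ω => (X ω, Y ω)) (x, y) = prob p Y y := by
      rw [prob_eq_sum_mul, prob_eq_sum_mul]
      refine Finset.sum_congr rfl fun ω' _ => ?_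
      by_cases h0 : p ω' = 0
      · simp [h0]
      · congr 1
        simp only [Prod.mk.injEq]
        by_cases hy' : Y ω' = y
        · simp [hy', (h ω' ω h0 hω (hy'.trans hy.symm)).trans hx]
        · simp [hy']
    rw [hprob]
    by_cases h0 : prob p Y y = 0 <;> simp [h0]
  · have hprob : prob p (fun ω => (X ω, Y ω)) (x, y) = 0 := by
      refine Finset.sum_eq_zero fun ω hω => ?_
      simp only [Finset.mem_filter, Finset.mem_univ, true_and, Prod.mk.injEq] at hω
      by_contra h0
      exact hxy ⟨ω, h0, hω⟩
    rw [hprob, zero_mul]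

/-- If `P(x, y, z) = g(y, z) P(x, z)` then `X` and `Y` are conditionally independent given `Z`. -/
theorem condMutualInfo_eq_zero (p : Ω → ℝ) (X : Ω → α) (Y : Ω → β) (Z : Ω → γ) (g : β → γ → ℝ)
    (h : ∀ x y z, prob p (fun ω => (X ω, Y ω, Z ω)) (x, y, z) =
      g y z * prob p (fun ω => (X ω, Z ω)) (x, z)) : condMutualInfo p X Y Z = 0 := by
  refine Finset.sum_eq_zero fun x _ => Finset.sum_eq_zero fun y _ =>
    Finset.sum_eq_zero fun z _ => ?_
  have hyz : prob p (fun ω => (Y ω, Z ω)) (y, z) = g y z * prob p Z z := by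
    rw [← sum_prob_prodMk p X (fun ω => (Y ω, Z ω)) (y, z), ← sum_prob_prodMk p X Z z,
      Finset.mul_sum]
    exact Finset.sum_congr rfl fun x _ => h x y z
  have key : prob p (fun ω => (X ω, Y ω, Z ω)) (x, y, z) * prob p Z z =
      prob p (fun ω => (X ω, Z ω)) (x, z) * prob p (fun ω => (Y ω, Z ω)) (y, z) := by
    rw [h, hyz]; ring
  rw [key]
  -- The ratio is 1, or else 0 because division by 0 gives 0; the logarithm vanishes either way.
  by_cases h0 : prob p (fun ω => (X ω, Z ω)) (x, z) * prob p (fun ω => (Y ω, Z ω)) (y, z) = 0 <;>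
    simp [h0]

end FiniteInfo

/-! ### Combinatorial private schemes and their passage to `Scheme`. -/

namespace MultiaccessCaching

/-- A multiaccess coded caching scheme with files, cache contents and messages in arbitrary
alphabets and with uniform server randomness, whose messages and retrieved contents determine the
demanded files, and in which any two demand vectors with the same demand of user `k` are related
by a relabelling of the randomness that user `k` cannot notice. -/
structure PrivateScheme (K L N : ℕ) (File C X : Type) where
  /-- The range of the server's randomness. -/
  Rand : Type
  /-- The range is finite. -/
  fintypeRand : Fintype Rand
  /-- The range is nonempty. -/
  nonemptyRand : Nonempty Rand
  /-- The placement function of each cache-node. -/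
  cache : Fin K → (Fin N → File) → Rand → C
  /-- The delivery function. -/
  send : Demands K N → (Fin N → File) → Rand → X
  /-- What a user observes determines its demanded file. -/
  decode : ∀ (k : Fin K) (d d' : Demands K N) (W W' : Fin N → File) (ρ ρ' : Rand), d k = d' k →
    send d W ρ = send d' W' ρ' →
    (∀ i : Fin L, cache (node k i) W ρ = cache (node k i) W' ρ') → W (d k) = W' (d k)
  /-- The demands of the other users are hidden by the randomness. -/
  hides : ∀ (k : Fin K) (W : Fin N → File) (d d' : Demands K N), d k = d' k →
    ∃ σ : Rand ≃ Rand, ∀ ρ, send d' W (σ ρ) = send d W ρ ∧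
      ∀ i : Fin L, cache (node k i) W (σ ρ) = cache (node k i) W ρ

attribute [instance] PrivateScheme.fintypeRand PrivateScheme.nonemptyRand

namespace PrivateScheme

variable {K L N B m l : ℕ}

open Classical in
/-- The uniform distribution on the diagonal: all cache-nodes share the server's randomness. -/
noncomputable def diagonalLaw (K : ℕ) (ρ : Type) [Fintype ρ] (v : Fin K → ρ) : ℝ :=
  ∑ r, if v = (fun _ => r) then (Fintype.card ρ : ℝ)⁻¹ else 0

theorem sum_diagonalLaw_mul {ρ : Type} [Fintype ρ] (h : (Fin K → ρ) → ℝ) [Fintype (Fin K → ρ)] :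
    ∑ v, diagonalLaw K ρ v * h v = (Fintype.card ρ : ℝ)⁻¹ * ∑ r, h fun _ => r := by
  classical
  simp only [diagonalLaw, Finset.sum_mul, ite_mul, zero_mul]
  rw [Finset.sum_comm]
  simp [Finset.mul_sum]

/-- A private scheme over bit strings, as a scheme in which all cache-nodes share the server's
randomness. -/
noncomputable def toScheme (s : PrivateScheme K L N (Bits B) (Bits m) (Bits l)) (k₀ : Fin K) :
    Scheme K N B m l where
  V _ := s.Rand
  fintypeV _ := s.fintypeRand
  law := diagonalLaw K s.Rand
  law_mem := by
    classical
    refine ⟨fun v => Finset.sum_nonneg fun r _ => ?_, ?_⟩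
    · split_ifs <;> positivity
    · have h := sum_diagonalLaw_mul (K := K) (ρ := s.Rand) fun _ => 1
      simpa using h
  cache k W r := s.cache k W r
  -- Almost surely all coordinates of `v` agree, so any fixed `k₀` serves.
  send d W v := s.send d W (v k₀)

variable (s : PrivateScheme K L N (Bits B) (Bits m) (Bits l)) (k₀ : Fin K)

theorem diagonalLaw_eq_zero {ρ : Type} [Fintype ρ] {v : Fin K → ρ}
    (hv : ∀ r, v ≠ fun _ => r) : diagonalLaw K ρ v = 0 := by
  classical
  exact Finset.sum_eq_zero fun r _ => if_neg (hv r)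

theorem toScheme_decodable : (s.toScheme k₀).Decodable L := by
  intro D _ k
  refine FiniteInfo.condEntropy_eq_zero _ _ _ ?_
  rintro ⟨W, v, d⟩ ⟨W', v', d'⟩ h h' hY
  have hdiag : ∀ (W : Library N B) (v : Fin K → s.Rand) (d : Demands K N),
      (s.toScheme k₀).joint D (W, v, d) ≠ 0 → ∃ r, v = fun _ => r := by
    intro W v d h
    by_contra! hv
    refine h ?_
    change _ * diagonalLaw K s.Rand v * _ = 0
    rw [diagonalLaw_eq_zero hv]
    simp
  obtain ⟨r, rfl⟩ := hdiag W v d h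
  obtain ⟨r', rfl⟩ := hdiag W' v' d' h'
  simp only [Prod.mk.injEq] at hY
  exact (s.decode k d d' W W' r r' hY.2.1 hY.1 fun i => congrFun hY.2.2 i).trans
    (congrArg W' hY.2.1)

/-- Expectations under the joint law of library, randomness and demands. -/
theorem sum_joint_mul (D : Demands K N → ℝ) (Ψ : (s.toScheme k₀).Outcome → ℝ) :
    ∑ ω, (s.toScheme k₀).joint D ω * Ψ ω = ∑ d, D d *
      ((Fintype.card (Library N B) : ℝ)⁻¹ * ∑ W, (Fintype.card s.Rand : ℝ)⁻¹ *
        ∑ r, Ψ (W, (fun _ => r), d)) := by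
  classical
  have h1 : ∀ (W : Library N B) (d : Demands K N),
      ∑ v : Fin K → s.Rand, diagonalLaw K s.Rand v * Ψ (W, v, d) =
        (Fintype.card s.Rand : ℝ)⁻¹ * ∑ r, Ψ (W, (fun _ => r), d) :=
    fun W d => sum_diagonalLaw_mul _
  simp only [← h1]
  rw [Fintype.sum_prod_type]
  simp only [Fintype.sum_prod_type_right, Finset.mul_sum]
  rw [Finset.sum_comm]
  refine Finset.sum_congr rfl fun d _ => Finset.sum_congr rfl fun W _ =>
    Finset.sum_congr ?_ fun v _ => ?_
  · ext v
    exact iff_of_true (Finset.mem_univ _) (Finset.mem_univ _)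
  · change (Fintype.card (Library N B) : ℝ)⁻¹ * diagonalLaw K s.Rand v * D d * _ = _
    ring

/-- By `hides`, for each library the law of what user `k` observes is the same for all demand
vectors with a given entry at `k`. So the conditional law `G` of the observations depends on `d k`
only, which is the factorisation that `condMutualInfo_eq_zero` needs. -/
theorem toScheme_private : (s.toScheme k₀).Private L := by
  classical
  intro D _ k
  set view : (s.toScheme k₀).Outcome → Bits l × (Fin L → Bits m) :=
    fun ω => ((s.toScheme k₀).message ω, (s.toScheme k₀).retrieved L k ω) with hview
  let G : Bits l × (Fin L → Bits m) → Demands K N → ℝ := fun y d =>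
    (Fintype.card (Library N B) : ℝ)⁻¹ * ∑ W, (Fintype.card s.Rand : ℝ)⁻¹ *
      ∑ r, if view (W, (fun _ => r), d) = y then 1 else 0
  have hG : ∀ y d d', d k = d' k → G y d = G y d' := by
    intro y d d' h
    simp only [G]
    congr 1
    refine Finset.sum_congr rfl fun W _ => ?_
    congr 1
    obtain ⟨σ, hσ⟩ := s.hides k W d d' h
    refine Eq.trans ?_ (σ.sum_comp fun r => if view (W, (fun _ => r), d') = y then (1 : ℝ) else 0)
    refine Finset.sum_congr rfl fun r _ => ?_
    have : view (W, (fun _ => σ r), d') = view (W, (fun _ => r), d) :=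
      Prod.ext (hσ r).1 (funext (hσ r).2)
    rw [this]
  -- The constant vector represents all demand vectors with entry `z` at `k`.
  refine FiniteInfo.condMutualInfo_eq_zero _ _ view _ (fun y z => G y fun _ => z) ?_
  intro x y z
  rw [FiniteInfo.prob_eq_sum_mul, FiniteInfo.prob_eq_sum_mul, sum_joint_mul, sum_joint_mul,
    Finset.mul_sum]
  refine Finset.sum_congr rfl fun d _ => ?_
  have hx : ∀ (W : Library N B) (r : s.Rand),
      (((s.toScheme k₀).otherDemands k (W, (fun _ => r), d),
        (s.toScheme k₀).demand k (W, (fun _ => r), d)) = (x, z)) =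
      ((fun j : {j : Fin K // j ≠ k} => d j) = x ∧ d k = z) := fun W r => by
    rw [Prod.mk.injEq]; rfl
  have hxy : ∀ (W : Library N B) (r : s.Rand),
      (((s.toScheme k₀).otherDemands k (W, (fun _ => r), d), view (W, (fun _ => r), d),
        (s.toScheme k₀).demand k (W, (fun _ => r), d)) = (x, y, z)) =
      (((fun j : {j : Fin K // j ≠ k} => d j) = x ∧ d k = z) ∧
        view (W, (fun _ => r), d) = y) := fun W r => by
    rw [Prod.mk.injEq, Prod.mk.injEq]
    exact propext ⟨fun h => ⟨⟨h.1, h.2.2⟩, h.2.1⟩, fun h => ⟨h.1.1, h.2, h.1.2⟩⟩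
  simp only [hx, hxy]
  by_cases hd : (fun j : {j : Fin K // j ≠ k} => d j) = x ∧ d k = z
  · simp only [hd, and_self, true_and, if_true]
    change D d * G y d = G y (fun _ => z) * _
    rw [hG y d (fun _ => z) hd.2]
    simp
    ring
  · simp [hd]

end PrivateScheme
end MultiaccessCaching

/-! ### Memory sharing and convexity. -/

namespace MultiaccessCaching

namespace PrivateScheme

variable {K L N : ℕ} {File File₁ File₂ C C₁ C₂ X X₁ X₂ : Type}

/-- Change of alphabets. -/
def map (s : PrivateScheme K L N File₁ C₁ X₁) (e : File₂ ≃ File₁) (f : C₁ ↪ C₂) (g : X₁ ↪ X₂) :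
    PrivateScheme K L N File₂ C₂ X₂ where
  Rand := s.Rand
  fintypeRand := s.fintypeRand
  nonemptyRand := s.nonemptyRand
  cache k W ρ := f (s.cache k (fun n => e (W n)) ρ)
  send d W ρ := g (s.send d (fun n => e (W n)) ρ)
  decode k d d' W W' ρ ρ' hd hX hZ := e.injective <|
    s.decode k d d' (fun n => e (W n)) (fun n => e (W' n)) ρ ρ' hd (g.injective hX)
      fun i => f.injective (hZ i)
  hides k W d d' hd := by
    obtain ⟨σ, hσ⟩ := s.hides k (fun n => e (W n)) d d' hd
    exact ⟨σ, fun ρ => ⟨congrArg g (hσ ρ).1, fun i => congrArg f ((hσ ρ).2 i)⟩⟩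

/-- Splitting of the files between two independent schemes. -/
def prod (s₁ : PrivateScheme K L N File₁ C₁ X₁) (s₂ : PrivateScheme K L N File₂ C₂ X₂) :
    PrivateScheme K L N (File₁ × File₂) (C₁ × C₂) (X₁ × X₂) where
  Rand := s₁.Rand × s₂.Rand
  fintypeRand := inferInstance
  nonemptyRand := inferInstance
  cache k W ρ := (s₁.cache k (fun n => (W n).1) ρ.1, s₂.cache k (fun n => (W n).2) ρ.2)
  send d W ρ := (s₁.send d (fun n => (W n).1) ρ.1, s₂.send d (fun n => (W n).2) ρ.2)
  decode k d d' W W' ρ ρ' hd hX hZ := Prod.ext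
    (s₁.decode k d d' (fun n => (W n).1) (fun n => (W' n).1) ρ.1 ρ'.1 hd (congrArg Prod.fst hX)
      fun i => congrArg Prod.fst (hZ i))
    (s₂.decode k d d' (fun n => (W n).2) (fun n => (W' n).2) ρ.2 ρ'.2 hd (congrArg Prod.snd hX)
      fun i => congrArg Prod.snd (hZ i))
  hides k W d d' hd := by
    obtain ⟨σ₁, h₁⟩ := s₁.hides k (fun n => (W n).1) d d' hd
    obtain ⟨σ₂, h₂⟩ := s₂.hides k (fun n => (W n).2) d d' hd
    exact ⟨σ₁.prodCongr σ₂, fun ρ => ⟨Prod.ext (h₁ ρ.1).1 (h₂ ρ.2).1,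
      fun i => Prod.ext ((h₁ ρ.1).2 i) ((h₂ ρ.2).2 i)⟩⟩

/-- Broadcasting of the whole library. -/
def uncoded (K L N : ℕ) (File : Type) : PrivateScheme K L N File Unit (Fin N → File) where
  Rand := Unit
  fintypeRand := inferInstance
  nonemptyRand := inferInstance
  cache _ _ _ := ()
  send _ W _ := W
  decode k d _ _ _ _ _ _ hX _ := congrFun hX (d k)
  hides _ _ _ _ _ := ⟨Equiv.refl _, fun _ => ⟨rfl, fun _ => rfl⟩⟩

end PrivateScheme

theorem card_bits (b : ℕ) : Fintype.card (Bits b) = 2 ^ b := by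
  simp [Bits, ZMod.card]

/-- Private schemes over alphabets of suitable cardinalities yield schemes over bit strings. -/
theorem PrivateScheme.exists_bits {K L N : ℕ} {File C X : Type} [Fintype File] [Fintype C]
    [Fintype X] (s : PrivateScheme K L N File C X) {B m l : ℕ} (hB : Fintype.card File = 2 ^ B)
    (hm : Fintype.card C ≤ 2 ^ m) (hl : Fintype.card X ≤ 2 ^ l) :
    Nonempty (PrivateScheme K L N (Bits B) (Bits m) (Bits l)) := by
  classical
  have e : Bits B ≃ File := Fintype.equivOfCardEq (by rw [card_bits, hB])
  obtain ⟨f⟩ := Function.Embedding.nonempty_of_card_le (α := C) (β := Bits m) (by rwa [card_bits])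
  obtain ⟨g⟩ := Function.Embedding.nonempty_of_card_le (α := X) (β := Bits l) (by rwa [card_bits])
  exact ⟨s.map e f g⟩

/-- Memory sharing of two schemes. -/
theorem exists_share {K L N B₁ B₂ m₁ m₂ l₁ l₂ : ℕ}
    (h₁ : Nonempty (PrivateScheme K L N (Bits B₁) (Bits m₁) (Bits l₁)))
    (h₂ : Nonempty (PrivateScheme K L N (Bits B₂) (Bits m₂) (Bits l₂))) :
    Nonempty (PrivateScheme K L N (Bits (B₁ + B₂)) (Bits (m₁ + m₂)) (Bits (l₁ + l₂))) := by
  obtain ⟨s₁⟩ := h₁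
  obtain ⟨s₂⟩ := h₂
  exact (s₁.prod s₂).exists_bits (by rw [Fintype.card_prod, card_bits, card_bits, pow_add])
    (by rw [Fintype.card_prod, card_bits, card_bits, pow_add])
    (by rw [Fintype.card_prod, card_bits, card_bits, pow_add])

/-- Meant for left-over bits: achievability has slack `ε` in the message but none in the caches, so
these bits must not use any cache. -/
theorem exists_uncoded (K L N r : ℕ) :
    Nonempty (PrivateScheme K L N (Bits r) (Bits 0) (Bits (N * r))) :=
  (PrivateScheme.uncoded K L N (Bits r)).exists_bits (card_bits r) (by simp)
    (by rw [Fintype.card_fun, card_bits, Fintype.card_fin, ← pow_mul, mul_comm])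

/-- Achievability by private schemes with coupled randomness. -/
def StronglyAchievable (K L N : ℕ) (M R : ℝ) : Prop :=
  ∀ ε : ℝ, 0 < ε → ∃ B₀ : ℕ, ∀ B : ℕ, B₀ ≤ B → ∃ m l : ℕ,
    (m : ℝ) ≤ M * B ∧ (l : ℝ) ≤ (R + ε) * B ∧
      Nonempty (PrivateScheme K L N (Bits B) (Bits m) (Bits l))

theorem StronglyAchievable.achievable {K L N : ℕ} (hK : 0 < K) {M R : ℝ}
    (h : StronglyAchievable K L N M R) : Achievable K L N M R := by
  intro ε hε
  obtain ⟨B₀, hB₀⟩ := h ε hε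
  refine ⟨B₀, fun B hB => ?_⟩
  obtain ⟨m, l, hm, hl, ⟨s⟩⟩ := hB₀ B hB
  exact ⟨m, l, hm, hl, s.toScheme ⟨0, hK⟩, s.toScheme_decodable _, s.toScheme_private _⟩

/-- A family of schemes for the multiples of a packet number `F`, whose message overhead `c` does
not depend on the packet size, achieves the corresponding memory-load pair. -/
theorem stronglyAchievable_of_packets {K L N F μ τ c : ℕ} {M R : ℝ} (hF : 0 < F)
    (h : ∀ b, Nonempty (PrivateScheme K L N (Bits (F * b)) (Bits (μ * b)) (Bits (τ * b + c))))
    (hM : (μ : ℝ) = M * F) (hR : (τ : ℝ) = R * F) : StronglyAchievable K L N M R := by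
  intro ε hε
  have hF' : (0 : ℝ) < F := by exact_mod_cast hF
  have hM0 : 0 ≤ M := by
    by_contra! hneg
    have := mul_neg_of_neg_of_pos hneg hF'
    have : (0 : ℝ) ≤ μ := Nat.cast_nonneg _
    linarith
  have hR0 : 0 ≤ R := by
    by_contra! hneg
    have := mul_neg_of_neg_of_pos hneg hF'
    have : (0 : ℝ) ≤ τ := Nat.cast_nonneg _
    linarith
  -- From here on `ε * B` pays for the overhead `c` and for the fewer than `F` left-over bits of
  -- each of the `N` files.
  obtain ⟨B₀, hB₀⟩ := exists_nat_ge (((c : ℝ) + N * F) / ε)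
  refine ⟨B₀, fun B hB => ?_⟩
  have hdm : F * (B / F) + B % F = B := Nat.div_add_mod B F
  have hdm' : (F : ℝ) * (B / F : ℕ) + (B % F : ℕ) = B := by exact_mod_cast hdm
  have hr : ((B % F : ℕ) : ℝ) ≤ F := by exact_mod_cast (Nat.mod_lt B hF).le
  have hr0 : (0 : ℝ) ≤ (B % F : ℕ) := Nat.cast_nonneg _
  refine ⟨μ * (B / F) + 0, τ * (B / F) + c + N * (B % F), ?_, ?_, ?_⟩
  · push_cast
    rw [hM]
    nlinarith [mul_nonneg hM0 hr0]
  · push_cast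
    rw [hR]
    have hBε : (c : ℝ) + N * F ≤ ε * B := by
      have : (B₀ : ℝ) ≤ B := by exact_mod_cast hB
      rw [div_le_iff₀ hε] at hB₀
      nlinarith
    have h1 : (N : ℝ) * (B % F : ℕ) ≤ N * F := mul_le_mul_of_nonneg_left hr (Nat.cast_nonneg _)
    nlinarith [mul_nonneg hR0 hr0]
  · have := exists_share (h (B / F)) (exists_uncoded K L N (B % F))
    rwa [hdm] at this

/-- Memory sharing: the achievable memory-load pairs form a convex set. -/
theorem convex_setOf_stronglyAchievable (K L N : ℕ) :
    Convex ℝ {q : ℝ × ℝ | 0 ≤ q.1 ∧ 0 ≤ q.2 ∧ StronglyAchievable K L N q.1 q.2} := by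
  rw [convex_iff_forall_pos]
  rintro ⟨M₁, R₁⟩ ⟨hM₁, hR₁, h₁⟩ ⟨M₂, R₂⟩ ⟨hM₂, hR₂, h₂⟩ a b ha hb hab
  simp only [Prod.smul_mk, smul_eq_mul, Prod.mk_add_mk, Set.mem_ofPred_eq] at *
  refine ⟨by positivity, by positivity, fun ε hε => ?_⟩
  obtain ⟨B₁, hB₁⟩ := h₁ (ε / 2) (half_pos hε)
  obtain ⟨B₂, hB₂⟩ := h₂ (ε / 2) (half_pos hε)
  -- `n₁` and `n₂` make both pieces long enough for their schemes; `n₃` lets `ε / 2 * B` absorb the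
  -- at most two bits per file lost to the two floors.
  obtain ⟨n₁, hn₁⟩ := exists_nat_ge ((B₁ : ℝ) / a)
  obtain ⟨n₂, hn₂⟩ := exists_nat_ge ((B₂ : ℝ) / b)
  obtain ⟨n₃, hn₃⟩ := exists_nat_ge ((N : ℝ) * 2 / (ε / 2))
  refine ⟨max n₁ (max n₂ n₃), fun B hB => ?_⟩
  simp only [max_le_iff] at hB
  obtain ⟨hBn₁, hBn₂, hBn₃⟩ := hB
  have hB0 : (0 : ℝ) ≤ B := Nat.cast_nonneg _
  have hc₁ : B₁ ≤ ⌊a * B⌋₊ := Nat.le_floor (by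
    rw [div_le_iff₀' ha] at hn₁
    exact hn₁.trans (mul_le_mul_of_nonneg_left (by exact_mod_cast hBn₁) ha.le))
  have hc₂ : B₂ ≤ ⌊b * B⌋₊ := Nat.le_floor (by
    rw [div_le_iff₀' hb] at hn₂
    exact hn₂.trans (mul_le_mul_of_nonneg_left (by exact_mod_cast hBn₂) hb.le))
  have hc₃ : (N : ℝ) * 2 ≤ ε / 2 * B := by
    rw [div_le_iff₀' (half_pos hε)] at hn₃
    exact hn₃.trans (mul_le_mul_of_nonneg_left (by exact_mod_cast hBn₃) (half_pos hε).le)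
  obtain ⟨m₁, l₁, hm₁, hl₁, s₁⟩ := hB₁ _ hc₁
  obtain ⟨m₂, l₂, hm₂, hl₂, s₂⟩ := hB₂ _ hc₂
  have hf₁ := Nat.floor_le (mul_nonneg ha.le hB0)
  have hf₂ := Nat.floor_le (mul_nonneg hb.le hB0)
  have hg₁ := Nat.lt_floor_add_one (a * (B : ℝ))
  have hg₂ := Nat.lt_floor_add_one (b * (B : ℝ))
  have hsplit : a * (B : ℝ) + b * B = B := by rw [← add_mul, hab, one_mul]
  generalize ⌊a * (B : ℝ)⌋₊ = b₁ at *
  generalize ⌊b * (B : ℝ)⌋₊ = b₂ at *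
  have hle : b₁ + b₂ ≤ B := by
    have : ((b₁ + b₂ : ℕ) : ℝ) ≤ B := by push_cast; linarith
    exact_mod_cast this
  obtain ⟨r, rfl⟩ := Nat.exists_eq_add_of_le hle
  have hr : (r : ℝ) ≤ 2 := by
    push_cast at *
    linarith
  refine ⟨m₁ + m₂ + 0, l₁ + l₂ + N * r, ?_, ?_,
    exists_share (exists_share s₁ s₂) (exists_uncoded K L N r)⟩
  -- Piece sizes are rounded down, so this bound relies on nonnegative memories.
  · have := mul_le_mul_of_nonneg_left hf₁ hM₁
    have := mul_le_mul_of_nonneg_left hf₂ hM₂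
    push_cast at *
    linarith
  · have := mul_le_mul_of_nonneg_left hf₁ (add_nonneg hR₁ (half_pos hε).le)
    have := mul_le_mul_of_nonneg_left hf₂ (add_nonneg hR₂ (half_pos hε).le)
    have := mul_le_mul_of_nonneg_left hr (Nat.cast_nonneg (α := ℝ) N)
    have hε2 := congrArg (fun x => ε / 2 * x) hsplit
    push_cast at *
    linarith

/-- Points of the lower convex envelope of strongly achievable points are achievable. -/
theorem achievable_of_mem_lowerConvexEnvelope {K L N : ℕ} (hK : 0 < K) {P : Set (ℝ × ℝ)}
    (hP : ∀ q ∈ P, 0 ≤ q.1 ∧ 0 ≤ q.2 ∧ StronglyAchievable K L N q.1 q.2) {M R : ℝ}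
    (h : (M, R) ∈ lowerConvexEnvelope P) : Achievable K L N M R := by
  refine StronglyAchievable.achievable hK fun ε hε => ?_
  have hglb : IsGLB {r : ℝ | (M, r) ∈ convexHull ℝ P} R := h
  -- Half of `ε` goes into approaching the infimum from within the hull, half into the scheme, so
  -- attainment is not needed.
  obtain ⟨r, hr, hrR⟩ := (isGLB_lt_iff hglb).1 (show R < R + ε / 2 by linarith)
  obtain ⟨-, -, hs⟩ := convexHull_min hP (convex_setOf_stronglyAchievable K L N) hr
  obtain ⟨B₀, hB₀⟩ := hs (ε / 2) (half_pos hε)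
  refine ⟨B₀, fun B hB => ?_⟩
  obtain ⟨m, l, hm, hl, s⟩ := hB₀ B hB
  exact ⟨m, l, hm, hl.trans (mul_le_mul_of_nonneg_right (by linarith) (Nat.cast_nonneg _)), s⟩

end MultiaccessCaching

/-! ### The point `(N / L, 0)`. -/

namespace MultiaccessCaching

theorem node_injective {K L : ℕ} (hLK : L ≤ K) (k : Fin K) :
    Function.Injective (node k : Fin L → Fin K) := by
  intro i i' h
  have h1 : (k.val + i.val) % K = (k.val + i'.val) % K := congrArg Fin.val h
  have h2 : i.val ≡ i'.val [MOD K] := Nat.ModEq.add_left_cancel' k.val h1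
  exact Fin.ext (h2.eq_of_lt_of_lt (i.2.trans_le hLK) (i'.2.trans_le hLK))

/-- The scheme without delivery: the cache-nodes store the files encoded with a Reed-Solomon code
of dimension `L`, evaluated at the distinct points `α`, so that any `L` of them determine the
library. -/
noncomputable def PrivateScheme.reedSolomon {K L : ℕ} (hLK : L ≤ K) (N b : ℕ) {E : Type} [Field E]
    (α : Fin K ↪ E) :
    PrivateScheme K L N (Fin b → Fin L → E) (Fin N → Fin b → E) Unit where
  Rand := Unit
  fintypeRand := inferInstance
  nonemptyRand := inferInstance
  cache k W _ := fun n x => ∑ j : Fin L, α k ^ (j : ℕ) * W n x j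
  send _ _ _ := ()
  decode k d d' W W' _ _ _ _ hZ := by
    funext x
    -- The difference of the two files gives a polynomial of degree below `L` with `L` distinct
    -- roots.
    refine sub_eq_zero.1 (Matrix.eq_zero_of_forall_index_sum_pow_mul_eq_zero
      (f := fun i : Fin L => α (node k i))
      (fun i i' h => node_injective hLK k (α.injective h)) fun i => ?_)
    have h := congrFun (congrFun (hZ i) (d k)) x
    simp only [Pi.sub_apply, mul_sub, Finset.sum_sub_distrib]
    exact sub_eq_zero.2 h
  hides _ _ _ _ _ := ⟨Equiv.refl _, fun _ => ⟨rfl, fun _ => rfl⟩⟩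

/-- The memory-load pair `(N / L, 0)`. -/
theorem stronglyAchievable_div_zero {K L N : ℕ} (hL : 1 ≤ L) (hLK : L ≤ K) :
    StronglyAchievable K L N ((N : ℝ) / L) 0 := by
  have hK : K ≠ 0 := by omega
  have hL0 : (L : ℝ) ≠ 0 := by exact_mod_cast (by omega : L ≠ 0)
  have : Fact (Nat.Prime 2) := ⟨Nat.prime_two⟩
  -- Degree `K` guarantees `K` evaluation points; a symbol then costs `K` bits, a factor that
  -- cancels in the memory.
  let _ : Fintype (GaloisField 2 K) := Fintype.ofFinite _
  have hE : Fintype.card (GaloisField 2 K) = 2 ^ K := by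
    rw [← Nat.card_eq_fintype_card, GaloisField.card 2 K hK]
  obtain ⟨α⟩ := Function.Embedding.nonempty_of_card_le (α := Fin K) (β := GaloisField 2 K)
    (by rw [hE, Fintype.card_fin]; exact Nat.lt_two_pow_self.le)
  refine stronglyAchievable_of_packets (F := K * L) (μ := K * N) (τ := 0) (c := 0)
    (Nat.mul_pos (by omega) hL) (fun b => ?_) (by push_cast; field_simp) (by simp)
  refine (PrivateScheme.reedSolomon hLK N b α).exists_bits ?_ ?_ ?_
  · rw [Fintype.card_fun, Fintype.card_fun, hE, Fintype.card_fin, Fintype.card_fin, ← pow_mul,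
      ← pow_mul, mul_assoc]
  · rw [Fintype.card_fun, Fintype.card_fun, hE, Fintype.card_fin, Fintype.card_fin, ← pow_mul,
      ← pow_mul, mul_assoc, mul_comm b N]
  · simp

end MultiaccessCaching

/-! ### Private delivery with secret-shared keys. -/

namespace MultiaccessCaching

/-- A placement of subfiles in cache-nodes and a multicast delivery of the missing subfiles.
Cache-node `v` stores the subfiles `stored v c` of all files, and user `k` lacks at most the
subfiles `missing k y`. In the transmission `j`, the users `x.1` of the pairs `x ∈ terms j` are
served the subfiles `x.2`. -/
structure DeliveryArray (K L : ℕ) (F S Y J : Type) where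
  /-- The subfiles stored in a cache-node. -/
  stored : Fin K → S → F
  /-- The subfiles that a user lacks. -/
  missing : Fin K → Y → F
  /-- The users and subfiles involved in a transmission. -/
  terms : J → Finset (Fin K × F)
  /-- Every user retrieves each subfile, or else lacks it and is served it by a transmission the
  other terms of which it retrieves. -/
  covers : ∀ k f, (∃ (i : Fin L) (c : S), stored (node k i) c = f) ∨
    ((∃ y, missing k y = f) ∧ ∃ j, (k, f) ∈ terms j ∧
      ∀ x ∈ terms j, x ≠ (k, f) → ∃ (i : Fin L) (c : S), stored (node k i) c = x.2)

section Keys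

variable {N : ℕ} {F A : Type} [AddCommGroup A] [Module (ZMod 2) A]

/-- The linear combination of the `f`-th subfiles of the library with coefficients `q`. -/
def combination (q : Fin N → ZMod 2) (W : Fin N → F → A) (f : F) : A := ∑ n, q n • W n f

theorem combination_add (q q' : Fin N → ZMod 2) (W : Fin N → F → A) (f : F) :
    combination (q + q') W f = combination q W f + combination q' W f := by
  simp [combination, add_smul, Finset.sum_add_distrib]

theorem combination_single (n : Fin N) (W : Fin N → F → A) (f : F) :
    combination (Pi.single n 1) W f = W n f := by
  simp [combination, Pi.single_apply]

theorem combination_congr (q : Fin N → ZMod 2) {W W' : Fin N → F → A} {f : F}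
    (h : ∀ n, W n f = W' n f) : combination q W f = combination q W' f := by
  simp [combination, h]

/-- The coefficients with which the server combines the files for user `k`: the demand, hidden by
the random vector `p k`. -/
def query {K N : ℕ} (d : Demands K N) (p : Fin K → Fin N → ZMod 2) (k : Fin K) :
    Fin N → ZMod 2 := p k + Pi.single (d k) 1

/-- The scheme in which user `k` is served the combinations of the files with coefficients
`query d p k`. Its keys, the combinations of its missing subfiles with coefficients `p k`, are
split into two additive shares, which are stored in its first and in its last cache-node. -/
noncomputable def DeliveryArray.keyScheme {K L : ℕ} {S Y J : Type} [Fintype Y] [Fintype A]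
    (a : DeliveryArray K L F S Y J) (far : Fin K ≃ Fin K)
    (hfirst : ∀ k : Fin K, ∃ i : Fin L, node k i = k) (hfar : ∀ k, ∃ i : Fin L, node k i = far k)
    (hsep : ∀ k j (i i' : Fin L), node k i = j → node k i' = far j → j = k) :
    PrivateScheme K L N (F → A) ((S → Fin N → A) × (Y → A) × (Y → A))
      ((J → A) × (Fin K → Fin N → ZMod 2)) where
  Rand := (Fin K → Fin N → ZMod 2) × (Fin K → Y → A)
  fintypeRand := by classical exact inferInstance
  nonemptyRand := ⟨0⟩
  cache v W ρ := (fun c n => W n (a.stored v c), ρ.2 v, fun y =>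
    ρ.2 (far.symm v) y + combination (ρ.1 (far.symm v)) W (a.missing (far.symm v) y))
  send d W ρ := (fun j => ∑ x ∈ a.terms j, combination (query d ρ.1 x.1) W x.2, query d ρ.1)
  decode k d d' W W' ρ ρ' hd hX hZ := by
    classical
    obtain ⟨hX1, hq⟩ := Prod.ext_iff.1 hX
    simp only at hX1 hq
    have hp : ρ.1 k = ρ'.1 k := by
      have h := congrFun hq k
      simp only [query, hd] at h
      exact add_right_cancel h
    have hknown : ∀ f, (∃ (i : Fin L) (c : S), a.stored (node k i) c = f) →
        ∀ n, W n f = W' n f := by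
      rintro f ⟨i, c, rfl⟩ n
      exact congrFun (congrFun (congrArg Prod.fst (hZ i)) c) n
    -- The key is the difference of the two shares, both of which user `k` retrieves.
    have hkey : ∀ y, combination (ρ.1 k) W (a.missing k y) =
        combination (ρ.1 k) W' (a.missing k y) := by
      intro y
      obtain ⟨i, hi⟩ := hfirst k
      obtain ⟨i', hi'⟩ := hfar k
      have h1 := congrFun (congrArg (fun z => z.2.1) (hZ i)) y
      have h2 := congrFun (congrArg (fun z => z.2.2) (hZ i')) y
      simp only [hi, hi', Equiv.symm_apply_apply] at h1 h2
      rw [h1, ← hp] at h2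
      exact add_left_cancel h2
    funext f
    rcases a.covers k f with hf | ⟨⟨y, rfl⟩, j, hj, hoth⟩
    · exact hknown f hf _
    · have h1 := congrFun hX1 j
      rw [← Finset.add_sum_erase _ _ hj, ← Finset.add_sum_erase _ _ hj, ← hq] at h1
      have h2 : ∑ x ∈ (a.terms j).erase (k, a.missing k y), combination (query d ρ.1 x.1) W x.2 =
          ∑ x ∈ (a.terms j).erase (k, a.missing k y), combination (query d ρ.1 x.1) W' x.2 :=
        Finset.sum_congr rfl fun x hx => combination_congr _ <|
          hknown _ (hoth x (Finset.mem_of_mem_erase hx) (Finset.ne_of_mem_erase hx))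
      rw [h2] at h1
      have h3 := add_right_cancel h1
      simp only [query, combination_add, combination_single] at h3
      rw [hkey] at h3
      exact add_left_cancel h3
  hides k W d d' hd := by
    classical
    -- Shifting `p` by `δ` keeps all queries. If user `k` sees the share in `far j`, then `τ` moves
    -- the share in node `j` so that the seen one is fixed. By `hsep`, `k` does not see node `j` as
    -- well unless `j = k`, and there `δ` vanishes.
    let δ : Fin K → Fin N → ZMod 2 := fun j => Pi.single (d j) 1 - Pi.single (d' j) 1
    let τ : Fin K → Y → A := fun j y =>
      if ∃ i : Fin L, node k i = far j then -combination (δ j) W (a.missing j y) else 0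
    have hδ : δ k = 0 := by simp [δ, hd]
    have hcomb0 : ∀ f, combination (0 : Fin N → ZMod 2) W f = 0 := fun f => by simp [combination]
    refine ⟨Equiv.addRight (δ, τ), fun ρ => ?_⟩
    have hquery : query d' (ρ.1 + δ) = query d ρ.1 := by
      funext j
      simp only [query, δ, Pi.add_apply]
      abel
    refine ⟨?_, fun i => ?_⟩
    · simp only [Equiv.coe_addRight, Prod.fst_add, hquery]
    · refine Prod.ext rfl (Prod.ext ?_ ?_)
      · funext y
        simp only [Equiv.coe_addRight, Prod.snd_add, Pi.add_apply, τ]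
        split_ifs with h
        · obtain ⟨i', hi'⟩ := h
          rw [hsep k _ i i' rfl hi', hδ, hcomb0]
          simp
        · simp
      · funext y
        obtain ⟨u, hu⟩ := far.surjective (node k i)
        simp only [Equiv.coe_addRight, Prod.snd_add, Prod.fst_add, Pi.add_apply, ← hu,
          Equiv.symm_apply_apply, combination_add, τ]
        rw [if_pos ⟨i, hu.symm⟩]
        abel

end Keys

end MultiaccessCaching

/-! ### The expanded placement array. -/

namespace MultiaccessCaching

/-- The position of `x` on the circle of cache-nodes after every element of `A` has been enlarged
to a block of length `L`. -/
def blockPos (L : ℕ) (A : Finset ℕ) (x : ℕ) : ℕ := x + (L - 1) * (A.filter (· < x)).card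

theorem blockPos_zero (L : ℕ) (A : Finset ℕ) : blockPos L A 0 = 0 := by simp [blockPos]

theorem blockPos_of_subset_range (L : ℕ) {A : Finset ℕ} {n : ℕ} (h : A ⊆ Finset.range n) :
    blockPos L A n = n + (L - 1) * A.card := by
  rw [blockPos, Finset.filter_true_of_mem fun x hx => Finset.mem_range.1 (h hx)]

theorem blockPos_succ_of_mem {L : ℕ} (hL : 1 ≤ L) {A : Finset ℕ} {x : ℕ} (hx : x ∈ A) :
    blockPos L A (x + 1) = blockPos L A x + L := by
  have : A.filter (· < x + 1) = insert x (A.filter (· < x)) := by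
    ext y
    simp only [Finset.mem_filter, Finset.mem_insert]
    constructor
    · rintro ⟨hy, hlt⟩
      by_cases h : y = x
      · exact Or.inl h
      · exact Or.inr ⟨hy, by omega⟩
    · rintro (rfl | ⟨hy, hlt⟩)
      · exact ⟨hx, by omega⟩
      · exact ⟨hy, by omega⟩
  rw [blockPos, blockPos, this, Finset.card_insert_of_notMem (by simp), mul_add]
  omega

theorem blockPos_succ_of_notMem (L : ℕ) {A : Finset ℕ} {x : ℕ} (hx : x ∉ A) :
    blockPos L A (x + 1) = blockPos L A x + 1 := by
  have : A.filter (· < x + 1) = A.filter (· < x) := by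
    refine Finset.filter_congr fun y hy => ?_
    have : y ≠ x := fun h => hx (h ▸ hy)
    omega
  rw [blockPos, blockPos, this]
  omega

theorem blockPos_insert_self (L : ℕ) (A : Finset ℕ) (x : ℕ) :
    blockPos L (insert x A) x = blockPos L A x := by
  rw [blockPos, blockPos, Finset.filter_insert, if_neg (lt_irrefl x)]

theorem blockPos_erase_of_le (L : ℕ) (A : Finset ℕ) {x y : ℕ} (h : x ≤ y) :
    blockPos L (A.erase y) x = blockPos L A x := by
  rw [blockPos, blockPos, Finset.filter_erase, Finset.erase_eq_of_notMem]
  simp only [Finset.mem_filter]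
  omega

theorem blockPos_erase_of_lt (L : ℕ) {A : Finset ℕ} {x y : ℕ} (hy : y ∈ A) (h : y < x) :
    blockPos L (A.erase y) x + (L - 1) = blockPos L A x := by
  have hmem : y ∈ A.filter (· < x) := Finset.mem_filter.2 ⟨hy, h⟩
  rw [blockPos, blockPos, Finset.filter_erase, ← Finset.card_erase_add_one hmem, mul_add]
  omega

/-- The circle is covered by the enlarged elements. -/
theorem exists_blockPos_le_lt (L : ℕ) (A : Finset ℕ) (n u : ℕ) (h : u < blockPos L A n) :
    ∃ x < n, blockPos L A x ≤ u ∧ u < blockPos L A (x + 1) := by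
  induction n with
  | zero => simp [blockPos_zero] at h
  | succ n ih =>
    by_cases hn : u < blockPos L A n
    · obtain ⟨x, hx, h'⟩ := ih hn
      exact ⟨x, by omega, h'⟩
    · exact ⟨n, by omega, by omega, h⟩

/-- Residues modulo `K` as users and cache-nodes. -/
def ofResidue {K : ℕ} [NeZero K] (z : ZMod K) : Fin K := ⟨z.val, ZMod.val_lt z⟩

theorem ofResidue_natCast {K : ℕ} [NeZero K] (k : Fin K) : ofResidue ((k : ℕ) : ZMod K) = k :=
  Fin.ext (ZMod.val_natCast_of_lt k.2)

theorem natCast_node {K L : ℕ} (k : Fin K) (i : Fin L) :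
    (((node k i : Fin K) : ℕ) : ZMod K) = (k : ℕ) + (i : ℕ) := by
  rw [node, ZMod.natCast_mod, Nat.cast_add]

/-- Indices of the subfiles placed according to `t`-subsets of `{0, …, n - 1}`, with one cyclic
shift for every residue modulo `K`. -/
abbrev ShiftedSubset (K n t : ℕ) : Type := ZMod K × Finset.powersetCard t (Finset.range n)

/-- A subset with a marked element. -/
abbrev MemPair (n t : ℕ) : Type := Σ A : Finset.powersetCard t (Finset.range n), A.1

/-- A subset with a marked element of its complement. -/
abbrev NotMemPair (n t : ℕ) : Type :=
  Σ A : Finset.powersetCard t (Finset.range n), ((Finset.range n \ A.1 : Finset ℕ))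

/-- The array of Maddah-Ali and Niesen with `n = K - t (L - 1)` users, expanded to a multiaccess array
with `K` users by enlarging the `t` marked positions to blocks of length `L`. -/
def expandedArray {K L n t : ℕ} [NeZero K] (hL : 1 ≤ L) (hn : n + (L - 1) * t = K) :
    DeliveryArray K L (ShiftedSubset K n t) (MemPair n t) (NotMemPair n t)
      (ShiftedSubset K n (t + 1)) where
  stored v c := ((v : ℕ) - (blockPos L c.1.1 c.2.1 : ℕ), c.1)
  missing k y := ((k : ℕ) + ((L - 1 : ℕ) : ZMod K) - (blockPos L y.1.1 y.2.1 : ℕ), y.1)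
  terms j := j.2.1.attach.image fun x : {x // x ∈ j.2.1} =>
    (ofResidue (j.1 + (blockPos L j.2.1 x : ℕ) - ((L - 1 : ℕ) : ZMod K)),
      (j.1, ⟨j.2.1.erase x, by
        have h := Finset.mem_powersetCard.1 j.2.2
        exact Finset.mem_powersetCard.2 ⟨(Finset.erase_subset _ _).trans h.1,
          by rw [Finset.card_erase_of_mem x.2, h.2, Nat.add_sub_cancel]⟩⟩))
  covers k f := by
    obtain ⟨j, A, hA⟩ := f
    have hA' := Finset.mem_powersetCard.1 hA
    have hretrieve : ∀ (B : Finset ℕ) (hB : B ∈ Finset.powersetCard t (Finset.range n)) (x : ℕ),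
        x ∈ B → ∀ i : ℕ, i < L → ((k : ℕ) : ZMod K) + (i : ℕ) = j + (blockPos L B x : ℕ) →
        ∃ (i : Fin L) (c : MemPair n t),
          ((((node k i : Fin K) : ℕ) : ZMod K) - (blockPos L c.1.1 c.2.1 : ℕ), c.1) =
            (j, (⟨B, hB⟩ : Finset.powersetCard t (Finset.range n))) := by
      intro B hB x hx i hi h
      refine ⟨⟨i, hi⟩, ⟨⟨B, hB⟩, ⟨x, hx⟩⟩, Prod.ext ?_ rfl⟩
      simp only [natCast_node, h, add_sub_cancel_right]
    -- `u` is the position of the last cache-node of `k` relative to the shift `j`. A subfile is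
    -- stored at the start of each block, so `k` retrieves it when `u` falls into a block of length
    -- `L`.
    set u : ZMod K := (k : ℕ) + ((L - 1 : ℕ) : ZMod K) - j with hu
    have hk : ((k : ℕ) : ZMod K) + ((L - 1 : ℕ) : ZMod K) = j + (u.val : ℕ) := by
      rw [ZMod.natCast_zmod_val, hu]; ring
    obtain ⟨x, hxn, hle, hlt⟩ := exists_blockPos_le_lt L A n u.val (by
      rw [blockPos_of_subset_range L hA'.1, hA'.2, hn]
      exact ZMod.val_lt u)
    by_cases hx : x ∈ A
    · left
      rw [blockPos_succ_of_mem hL hx] at hlt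
      obtain ⟨e, he⟩ := Nat.exists_eq_add_of_le hle
      obtain ⟨i, hi⟩ := Nat.exists_eq_add_of_le (show e ≤ L - 1 by omega)
      refine hretrieve A hA x hx i (by omega) ?_
      rw [he, hi] at hk
      push_cast at hk
      linear_combination hk
    · right
      -- Otherwise `u` is an unenlarged position `x`, and the transmission of `insert x A` serves
      -- `k`.
      rw [blockPos_succ_of_notMem L hx] at hlt
      have hux : u.val = blockPos L A x := by omega
      rw [hux] at hk
      have hS : insert x A ∈ Finset.powersetCard (t + 1) (Finset.range n) :=
        Finset.mem_powersetCard.2 ⟨Finset.insert_subset (Finset.mem_range.2 hxn) hA'.1,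
          by rw [Finset.card_insert_of_notMem hx, hA'.2]⟩
      refine ⟨⟨⟨⟨A, hA⟩, ⟨x, Finset.mem_sdiff.2 ⟨Finset.mem_range.2 hxn, hx⟩⟩⟩,
        Prod.ext (by simp only; rw [hk]; ring) rfl⟩, (j, ⟨insert x A, hS⟩), ?_, ?_⟩
      · refine Finset.mem_image.2 ⟨⟨x, Finset.mem_insert_self x A⟩, Finset.mem_attach _ _, ?_⟩
        refine Prod.ext ?_ (Prod.ext rfl (Subtype.ext (Finset.erase_insert hx)))
        simp only [blockPos_insert_self, ← hk, add_sub_cancel_right, ofResidue_natCast]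
      · intro z hz hne
        obtain ⟨⟨y, hy⟩, -, rfl⟩ := Finset.mem_image.1 hz
        simp only at hy hne ⊢
        have hyx : y ≠ x := by
          rintro rfl
          refine hne (Prod.ext ?_ (Prod.ext rfl (Subtype.ext (Finset.erase_insert hx))))
          simp only [blockPos_insert_self, ← hk, add_sub_cancel_right, ofResidue_natCast]
        have hmem : x ∈ (insert x A).erase y :=
          Finset.mem_erase.2 ⟨hyx.symm, Finset.mem_insert_self x A⟩
        rw [← blockPos_insert_self] at hk
        -- Unmarking some `y` below `x` pulls the block of `x` back by `L - 1`, so it starts at the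
        -- first cache-node of `k`; unmarking one above `x` leaves its start at the last cache-node.
        rcases lt_or_gt_of_ne hyx with h | h
        · refine hretrieve _ _ x hmem 0 (by omega) ?_
          rw [← blockPos_erase_of_lt L hy h] at hk
          push_cast at hk ⊢
          linear_combination hk
        · refine hretrieve _ _ x hmem (L - 1) (by omega) ?_
          rw [blockPos_erase_of_le L _ h.le, hk]

/-! ### Parameters of the key scheme. -/

theorem card_memPair (n t : ℕ) : Fintype.card (MemPair n t) = n.choose t * t := by
  rw [Fintype.card_sigma, Finset.sum_congr rfl (g := fun _ => t)]
  · simp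
  · intro A _
    rw [Fintype.card_coe, (Finset.mem_powersetCard.1 A.2).2]

theorem card_notMemPair (n t : ℕ) : Fintype.card (NotMemPair n t) = n.choose t * (n - t) := by
  rw [Fintype.card_sigma, Finset.sum_congr rfl (g := fun _ => n - t)]
  · simp
  · intro A _
    have h := Finset.mem_powersetCard.1 A.2
    rw [Fintype.card_coe, Finset.card_sdiff_of_subset h.1, h.2, Finset.card_range]

theorem card_shiftedSubset (K n t : ℕ) [NeZero K] :
    Fintype.card (ShiftedSubset K n t) = K * n.choose t := by
  simp [ShiftedSubset, ZMod.card]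

/-- With less than `K / 2 + 1` cache-nodes per user, only user `j` accesses both the first and the
last cache-node of user `j`. -/
theorem eq_of_node_eq {K L : ℕ} (h2 : 2 * L < K + 2) {k j : Fin K} {i i' e : Fin L}
    (he : (e : ℕ) = L - 1) (h : node k i = j) (h' : node k i' = node j e) : j = k := by
  have h0 : (k.val + i.val) % K = j.val := congrArg Fin.val h
  have h1 : (k.val + i'.val) % K = (j.val + e.val) % K := congrArg Fin.val h'
  have h3 : k.val + i'.val ≡ k.val + (i.val + e.val) [MOD K] := by
    rw [← h0, Nat.mod_add_mod] at h1
    rw [← add_assoc]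
    exact h1
  have h4 := Nat.ModEq.add_left_cancel' _ h3
  have hi := i.2
  have hi' := i'.2
  -- The congruence is an equality because `i + e ≤ 2 * (L - 1) < K`. As `i' ≤ e`, it forces `i =
  -- 0`.
  have h5 : i'.val = i.val + e.val := h4.eq_of_lt_of_lt (by omega) (by omega)
  have h6 : i.val = 0 := by omega
  rw [h6, add_zero, Nat.mod_eq_of_lt k.2] at h0
  exact Fin.ext h0.symm

/-- The memory-load pairs of the key scheme for the expanded array. -/
theorem stronglyAchievable_expandedArray {K L N t : ℕ} (hL : 1 ≤ L) (hK : 0 < K)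
    (h2 : 2 * L < K + 2) (ht : t * L ≤ K) :
    StronglyAchievable K L N (((N : ℝ) - 2 * L) * t / K + 2) (((K : ℝ) - t * L) / (t + 1)) := by
  have : NeZero K := ⟨hK.ne'⟩
  obtain ⟨r, hr⟩ := Nat.exists_eq_add_of_le ht
  obtain ⟨e, rfl⟩ := Nat.exists_eq_add_of_le' hL
  have hn : (t + r) + (e + 1 - 1) * t = K := by
    rw [hr, Nat.add_sub_cancel]; ring
  let last : Fin (e + 1) := ⟨e, by omega⟩
  have hinj : Function.Injective fun k : Fin K => node k last := by
    intro k k' h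
    have h1 : (k.val + e) % K = (k'.val + e) % K := congrArg Fin.val h
    exact Fin.ext ((Nat.ModEq.add_right_cancel' e h1).eq_of_lt_of_lt k.2 k'.2)
  let far : Fin K ≃ Fin K := Equiv.ofBijective _ (Finite.injective_iff_bijective.1 hinj)
  have hfirst : ∀ k : Fin K, ∃ i : Fin (e + 1), node k i = k := fun k =>
    ⟨0, Fin.ext (by simp [node, Nat.mod_eq_of_lt k.2])⟩
  have hc : 0 < (t + r).choose t := Nat.choose_pos (by omega)
  have hK' : (K : ℝ) ≠ 0 := by exact_mod_cast hK.ne'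
  have hKr : (K : ℝ) = t * (e + 1) + r := by exact_mod_cast hr
  -- Here `r = K - t * L` is the number of unmarked positions. A cache holds `choose * t` subfiles
  -- of each file and two families of `choose * r` shares; the public queries are the `K * N`
  -- overhead bits.
  refine stronglyAchievable_of_packets (F := K * (t + r).choose t)
    (μ := N * ((t + r).choose t * t) + 2 * ((t + r).choose t * r))
    (τ := K * (t + r).choose (t + 1)) (c := K * N) (Nat.mul_pos hK hc) (fun b => ?_) ?_ ?_
  · refine ((expandedArray hL hn).keyScheme (A := Bits b) (N := N) far hfirst
      (fun k => ⟨last, rfl⟩) fun k j i i' h h' => eq_of_node_eq h2 rfl h h').exists_bits ?_ ?_ ?_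
    · rw [Fintype.card_fun, card_bits, card_shiftedSubset, ← pow_mul, mul_comm]
    · refine le_of_eq ?_
      simp only [Fintype.card_prod, Fintype.card_fun, card_memPair, card_notMemPair,
        Fintype.card_fin, ← pow_mul, ← pow_add, Nat.add_sub_cancel_left]
      congr 1
      ring
    · refine le_of_eq ?_
      simp only [Fintype.card_prod, Fintype.card_fun, Fintype.card_coe, Finset.card_powersetCard,
        Finset.card_range, Fintype.card_fin, ZMod.card, ← pow_mul, ← pow_add]
      congr 1
      ring
  · push_cast
    field_simp
    rw [hKr]
    ring
  · have h := Nat.choose_succ_right_eq (t + r) t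
    rw [Nat.add_sub_cancel_left] at h
    have h' : ((t + r).choose (t + 1) : ℝ) * (t + 1) = (t + r).choose t * r := by exact_mod_cast h
    have ht1 : (t : ℝ) + 1 ≠ 0 := by positivity
    push_cast
    rw [show (K : ℝ) - t * (e + 1) = r by rw [hKr]; ring]
    field_simp
    linear_combination h'

end MultiaccessCaching

/-! ### The envelope of the corner points. -/

theorem theorem2 (K L N : ℕ) (hL : 1 ≤ L) (hLK : L ≤ K) (hN : 1 ≤ N) (M R : ℝ)
    (hMR : (M, R) ∈ MultiaccessCaching.lowerConvexEnvelope
      ({q : ℝ × ℝ | (L : ℝ) < (K : ℝ) / 2 + 1 ∧ ∃ t : ℕ, 1 ≤ t ∧ t ≤ ⌊(K : ℝ) / (L : ℝ)⌋₊ ∧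
          q = (((N : ℝ) - 2 * L) * t / K + 2, ((K : ℝ) - t * L) / (t + 1))} ∪
        {((N : ℝ) / (L : ℝ), (0 : ℝ))})) :
    MultiaccessCaching.Achievable K L N M R := by
  have hK : 0 < K := by omega
  have hL0 : (0 : ℝ) < L := by exact_mod_cast hL
  have hK0 : (0 : ℝ) < K := by exact_mod_cast hK
  refine MultiaccessCaching.achievable_of_mem_lowerConvexEnvelope hK ?_ hMR
  rintro q (⟨h2, t, -, ht, rfl⟩ | rfl)
  · have ht' : (t : ℝ) * L ≤ K :=
      (le_div_iff₀ hL0).1 ((Nat.le_floor_iff (by positivity)).1 ht)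
    have h2' : 2 * L < K + 2 := by
      have : 2 * (L : ℝ) < K + 2 := by linarith
      exact_mod_cast this
    refine ⟨?_, div_nonneg (by linarith) (by positivity),
      MultiaccessCaching.stronglyAchievable_expandedArray hL hK h2' (by exact_mod_cast ht')⟩
    -- Convexity was shown for nonnegative pairs only; `N - 2 * L` may be negative, but `t * L ≤ K`
    -- compensates.
    have h : ((N : ℝ) - 2 * L) * t / K + 2 = (N * t + 2 * (K - t * L)) / K := by
      field_simp
      ring
    rw [h]
    exact div_nonneg (add_nonneg (by positivity) (by linarith)) hK0.le
  · exact ⟨by positivity, le_rfl, MultiaccessCaching.stronglyAchievable_div_zero hL hLK⟩
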